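/- Let $\gamma$ be the Euler–Mascheroni constant and let $\gamma_1$ be the first Stieltjes constant of the Riemann zeta function, that is, $$\gamma_1 = -\lim_{s\to 1}\left[\zeta'(s)+\frac{1}{(s-1)^2}\right]$$ (a limit which exists, taken over complex $s\neq 1$). Then the following series converges absolutely and $$\sum_{n=0}^{\infty}\frac{1}{n+1}\sum_{k=0}^{n}\binom{n}{k}(-1)^k\,k\,\log^2(k+1)=\gamma_1-\log(2\pi)-\frac{1}{2}\gamma^2+\frac{1}{24}\pi^2+\frac{1}{2}\log^2(2\pi).$$ -/

import Mathlib

open Filter Topology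

/-- The function of `s` whose limit as `s → 1`, `s ≠ 1`, defines the `p`-th Stieltjes constant:
`(-1)^p (ζ^{(p)}(s) - (-1)^p p! / (s - 1)^{p+1})`. -/
noncomputable def stieltjesFun (p : ℕ) (s : ℂ) : ℂ :=
  (-1) ^ p * (iteratedDeriv p riemannZeta s - (-1) ^ p * (p.factorial : ℂ) / (s - 1) ^ (p + 1))

/-- The `p`-th Stieltjes constant
`γ_p = (-1)^p lim_{s → 1} [ζ^{(p)}(s) - (-1)^p p! / (s - 1)^{p+1}]`; thus `(-1)^p γ_p / p!` is the
coefficient of `(s - 1)^p` in the Laurent expansion of `ζ` at `1`. -/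
noncomputable def stieltjesConstant (p : ℕ) : ℂ :=
  limUnder (𝓝[≠] (1 : ℂ)) (stieltjesFun p)

/-! Write Z(s) = (s - 1)ζ(s), the entire function `riemannZeta₁`. Hasse's series (`hasSum_hasse`)
expands Z(s) in binomial sums of (k+1)^(1-s). Since (k+1)^(1-s) - (k+1)^(-s) = k(k+1)^(-s),
subtracting the series at 1 + s gives Z(s) - Z(1+s) = ∑ `hasseDiffTerm n s`, and two derivatives at
s = 0 produce log²(k+1). The sum is therefore Z''(0) - Z''(1).

Hasse's series is only established for re s > 2. A summable bound on a disc containing 0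
(`exists_summable_bound_hasseDiffTerm`) lets the differenced identity continue to 0 and be
differentiated termwise.

With ζ(s) = 1/(s-1) + ζ₀(s), one has γ₁ = -ζ₀'(1) and Z''(1) = 2ζ₀'(1). The functional equation,
expanded to second order, gives Z''(0) = ζ₀'(1) plus the explicit constants, so the difference is γ₁
plus those constants. -/

/-! ### Calculus of second-order jets. -/

/-- `f` is analytic at `x` with value `a`, first derivative `b` and second derivative `c`. -/
structure HasTwoJetAt (f : ℂ → ℂ) (x a b c : ℂ) : Prop where
  analyticAt : AnalyticAt ℂ f x
  value : f x = a
  deriv_eq : deriv f x = b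
  iteratedDeriv_eq : iteratedDeriv 2 f x = c

namespace HasTwoJetAt

variable {f g : ℂ → ℂ} {x a b c a' b' c' : ℂ}

lemma mul (hf : HasTwoJetAt f x a b c) (hg : HasTwoJetAt g x a' b' c') :
    HasTwoJetAt (fun u ↦ f u * g u) x (a * a') (b * a' + a * b')
      (c * a' + 2 * (b * b') + a * c') := by
  refine ⟨hf.analyticAt.fun_mul hg.analyticAt, by simp [hf.value, hg.value], ?_, ?_⟩
  · rw [deriv_fun_mul hf.analyticAt.differentiableAt hg.analyticAt.differentiableAt, hf.value,
      hg.value, hf.deriv_eq, hg.deriv_eq]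
  · rw [iteratedDeriv_fun_mul hf.analyticAt.contDiffAt hg.analyticAt.contDiffAt]
    simp only [Finset.sum_range_succ, Finset.sum_range_zero, iteratedDeriv_zero, iteratedDeriv_one,
      hf.value, hf.deriv_eq, hf.iteratedDeriv_eq, hg.iteratedDeriv_eq]
    norm_num [hf.value, hg.value, hf.deriv_eq, hg.deriv_eq, hf.iteratedDeriv_eq,
      hg.iteratedDeriv_eq]
    ring

lemma congr (hf : HasTwoJetAt f x a b c) (h : f =ᶠ[𝓝 x] g) : HasTwoJetAt g x a b c :=
  ⟨hf.analyticAt.congr h, h.eq_of_nhds ▸ hf.value, h.deriv_eq ▸ hf.deriv_eq,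
    h.iteratedDeriv_eq 2 ▸ hf.iteratedDeriv_eq⟩

lemma comp_neg (hf : HasTwoJetAt f 0 a b c) : HasTwoJetAt (fun u ↦ f (-u)) 0 a (-b) c := by
  refine ⟨?_, by simp [hf.value], by simp [deriv_comp_neg, hf.deriv_eq], ?_⟩
  · exact AnalyticAt.fun_comp (by simpa using hf.analyticAt) (by fun_prop)
  · simp [iteratedDeriv_comp_neg, hf.iteratedDeriv_eq]

lemma comp_const_add (y : ℂ) (hf : HasTwoJetAt f y a b c) :
    HasTwoJetAt (fun u ↦ f (y + u)) 0 a b c := by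
  refine ⟨?_, by simp [hf.value], by simp [deriv_comp_const_add, hf.deriv_eq], ?_⟩
  · exact AnalyticAt.fun_comp (by simpa using hf.analyticAt) (by fun_prop)
  · simp [iteratedDeriv_comp_const_add, hf.iteratedDeriv_eq]

lemma comp_const_mul (hd : Differentiable ℂ f) (r : ℂ) (hf : HasTwoJetAt f 0 a b c) :
    HasTwoJetAt (fun u ↦ f (r * u)) 0 a (r * b) (r ^ 2 * c) := by
  have h := fun n ↦ iteratedDeriv_comp_const_mul (n := n) hd.contDiff r
  refine ⟨?_, by simp [hf.value], ?_, ?_⟩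
  · exact AnalyticAt.fun_comp (by simpa using hf.analyticAt) (by fun_prop)
  · rw [← iteratedDeriv_one, h]; simp [hf.deriv_eq]
  · rw [h]; simp [hf.iteratedDeriv_eq]

end HasTwoJetAt

/-! ### Jets of sinc and Γ. -/

/-- The entire function `sin z / z`. -/
noncomputable def complexSinc : ℂ → ℂ := dslope Complex.sin 0

lemma mul_complexSinc (z : ℂ) : z * complexSinc z = Complex.sin z := by
  simpa [complexSinc] using sub_smul_dslope Complex.sin 0 z

lemma differentiable_complexSinc : Differentiable ℂ complexSinc := by
  rw [← differentiableOn_univ]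
  exact (Complex.differentiableOn_dslope univ_mem).2 Complex.differentiable_sin.differentiableOn

/-- By Leibniz applied to z · sinc z at 0, only the term differentiating z once survives. -/
lemma hasTwoJetAt_complexSinc : HasTwoJetAt complexSinc 0 1 0 (-1 / 3) := by
  have hd := differentiable_complexSinc
  have key (n : ℕ) : iteratedDeriv (n + 1) Complex.sin 0 =
      (n + 1) * iteratedDeriv n complexSinc 0 := by
    have h : Complex.sin = fun z ↦ z * complexSinc z := funext fun z ↦ (mul_complexSinc z).symm
    rw [h, iteratedDeriv_fun_mul (f := fun z ↦ z) (by fun_prop) hd.contDiff.contDiffAt,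
      Finset.sum_eq_single 1]
    · simp [iteratedDeriv_one]
    · intro i _ hi
      rw [iteratedDeriv_fun_id]
      simp [hi]
    · simp
  refine ⟨hd.analyticAt 0, ?_, ?_, ?_⟩
  · simpa [iteratedDeriv_one] using (key 0).symm
  · have := key 1
    rw [iteratedDeriv_succ, iteratedDeriv_one, iteratedDeriv_one] at this
    simpa using this
  · have := key 2
    simp [iteratedDeriv_succ, iteratedDeriv_zero] at this
    rw [iteratedDeriv_succ, iteratedDeriv_one]
    linear_combination -this / 3

lemma analyticAt_Gamma_one : AnalyticAt ℂ Complex.Gamma 1 := by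
  have h : AnalyticAt ℂ (fun s ↦ (Complex.Gamma s)⁻¹) 1 :=
    Complex.differentiable_one_div_Gamma.analyticAt 1
  simpa using h.fun_inv (by simp)

/-- The 2-jet of `Γ` at `1`. -/
lemma hasTwoJetAt_Gamma_one : HasTwoJetAt Complex.Gamma 1 1 (-Real.eulerMascheroniConstant)
    (Real.eulerMascheroniConstant ^ 2 + Real.pi ^ 2 / 6) := by
  -- Only c is unknown. The reflection formula Γ(1+u)Γ(1-u) sinc(πu) = 1 at second order reads 2c -
  -- 2γ² - π²/3 = 0.
  obtain ⟨c, hc⟩ : ∃ c, HasTwoJetAt Complex.Gamma 1 1 (-Real.eulerMascheroniConstant) c :=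
    ⟨_, analyticAt_Gamma_one, Complex.Gamma_one, Complex.hasDerivAt_Gamma_one.deriv, rfl⟩
  have h1 := hc.comp_const_add
  have h2 := h1.comp_neg
  have h3 := hasTwoJetAt_complexSinc.comp_const_mul differentiable_complexSinc Real.pi
  have h4 := (h1.mul h2).mul h3
  have h5 := h4.congr (g := fun _ ↦ (1 : ℂ)) <| by
    have : ∀ᶠ u : ℂ in 𝓝 0, u ∈ Metric.ball (0 : ℂ) 1 := Metric.ball_mem_nhds _ one_pos
    filter_upwards [this] with u hu
    rcases eq_or_ne u 0 with rfl | h0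
    · simp [hasTwoJetAt_complexSinc.value]
    have hs : Complex.sin (Real.pi * u) ≠ 0 := by
      rw [Ne, Complex.sin_eq_zero_iff]
      rintro ⟨k, hk⟩
      have hk' : u = k := by
        have : (Real.pi : ℂ) ≠ 0 := by exact_mod_cast Real.pi_ne_zero
        apply mul_left_cancel₀ this
        rw [hk]; ring
      subst hk'
      have hk1 : |(k : ℝ)| < 1 := by simpa [Complex.norm_intCast] using hu
      have : |k| < 1 := by exact_mod_cast hk1
      exact h0 (by simp [Int.abs_lt_one_iff.1 this])
    have hr := Complex.Gamma_mul_Gamma_one_sub u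
    rw [eq_div_iff hs] at hr
    have hm := mul_complexSinc (Real.pi * u)
    rw [add_comm 1 u, Complex.Gamma_add_one u h0, ← sub_eq_add_neg]
    have hpi : (Real.pi : ℂ) ≠ 0 := by exact_mod_cast Real.pi_ne_zero
    apply mul_left_cancel₀ hpi
    linear_combination hr + Complex.Gamma u * Complex.Gamma (1 - u) * hm
  have h6 := h5.iteratedDeriv_eq
  rw [iteratedDeriv_const] at h6
  norm_num at h6
  convert hc using 1
  linear_combination h6 / 2

/-! ### Second derivatives of (s - 1)ζ(s) at 1 and 0. -/

lemma hasTwoJetAt_riemannZeta₁_one : HasTwoJetAt riemannZeta₁ 1 1 Real.eulerMascheroniConstant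
    (2 * deriv riemannZeta₀ 1) := by
  refine ⟨differentiable_riemannZeta₁.analyticAt 1, riemannZeta₁_one, deriv_riemannZeta₁_one, ?_⟩
  have h : riemannZeta₁ = fun s ↦ 1 + (s - 1) * riemannZeta₀ s := rfl
  have hd := differentiable_riemannZeta₀
  have h1 : deriv riemannZeta₁ = fun s ↦ riemannZeta₀ s + (s - 1) * deriv riemannZeta₀ s := by
    ext s
    rw [h, deriv_const_add, deriv_fun_mul (by fun_prop) (by fun_prop)]
    simp
  have hd' : Differentiable ℂ (deriv riemannZeta₀) := hd.deriv
  rw [iteratedDeriv_succ, iteratedDeriv_one, h1, deriv_fun_add (by fun_prop) (by fun_prop),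
    deriv_fun_mul (by fun_prop) (by fun_prop)]
  simp
  ring

lemma hasTwoJetAt_cpow_neg {b : ℂ} (hb : b ≠ 0) : HasTwoJetAt (fun u : ℂ ↦ b ^ (-u)) 0 1
    (-Complex.log b) (Complex.log b ^ 2) := by
  have h : deriv (fun u : ℂ ↦ b ^ (-u)) = fun u ↦ (-Complex.log b) * b ^ (-u) := by
    ext u
    have := ((hasDerivAt_id u).neg).const_cpow (c := b) (Or.inl hb)
    simp only [Pi.neg_apply, id] at this
    refine (HasDerivAt.deriv (f := fun u : ℂ ↦ b ^ (-u)) this).trans ?_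
    ring
  have hd : Differentiable ℂ (fun u : ℂ ↦ b ^ (-u)) := fun u ↦
    (differentiableAt_id.neg).const_cpow (Or.inl hb)
  refine ⟨hd.analyticAt 0, by simp, by simp [h], ?_⟩
  rw [iteratedDeriv_succ, iteratedDeriv_one, h, deriv_const_mul _ (hd 0), h]
  simp
  ring

/-- The functional equation with its singularity removed: the zero of cos(π(1+u)/2) = -sin(πu/2) at
u = 0 cancels the pole of ζ(1+u). Continuity then covers u = 0. -/
lemma riemannZeta₁_neg_eventuallyEq :
    (fun u ↦ (1 / 2 * (1 + u)) * ((2 * Real.pi : ℂ) ^ (-u) * Complex.Gamma (1 + u) *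
      complexSinc (Real.pi / 2 * u) * riemannZeta₁ (1 + u))) =ᶠ[𝓝 0]
      fun u ↦ riemannZeta₁ (-u) := by
  have : ∀ᶠ u : ℂ in 𝓝 0, u ∈ Metric.ball (0 : ℂ) 1 := Metric.ball_mem_nhds _ one_pos
  have hpi : (Real.pi : ℂ) ≠ 0 := by exact_mod_cast Real.pi_ne_zero
  have key : ∀ᶠ u : ℂ in 𝓝[≠] 0, (1 / 2 * (1 + u)) * ((2 * Real.pi : ℂ) ^ (-u) *
      Complex.Gamma (1 + u) * complexSinc (Real.pi / 2 * u) * riemannZeta₁ (1 + u)) =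
      riemannZeta₁ (-u) := by
    filter_upwards [nhdsWithin_le_nhds this, self_mem_nhdsWithin] with u hu h0
    have h0 : u ≠ 0 := h0
    have hu' : ‖u‖ < 1 := by simpa using hu
    have hfe := riemannZeta_one_sub (s := 1 + u) (fun n hn ↦ by
      have h1 : u = -((n + 1 : ℕ) : ℂ) := by push_cast; linear_combination hn
      rw [h1, norm_neg, Complex.norm_natCast] at hu'
      norm_num at hu'
      linarith [n.cast_nonneg (α := ℝ)]) (by simp [h0])
    have hm1 : -u ≠ 1 := fun h ↦ by
      rw [← norm_neg, h] at hu'; simp at hu'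
    have h1 : 1 + u ≠ 1 := by simpa using h0
    rw [show 1 - (1 + u) = -u by ring, riemannZeta_eq_inv_sub_mul hm1,
      riemannZeta_eq_inv_sub_mul h1] at hfe
    have hm1' : -u - 1 ≠ 0 := sub_ne_zero.2 hm1
    rw [inv_mul_eq_iff_eq_mul₀ hm1'] at hfe
    rw [hfe]
    have hcos : Complex.cos (Real.pi * (1 + u) / 2) = -(Real.pi / 2 * u *
        complexSinc (Real.pi / 2 * u)) := by
      rw [mul_complexSinc, ← Complex.cos_add_pi_div_two]
      congr 1; ring
    have hpow : (2 * Real.pi : ℂ) ^ (-(1 + u)) = (2 * Real.pi : ℂ) ^ (-u) / (2 * Real.pi) := by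
      rw [show -(1 + u) = -u - 1 by ring, Complex.cpow_sub _ _ (by simp [hpi]),
        Complex.cpow_one]
    rw [hcos, hpow, add_sub_cancel_left]
    field_simp
    ring
  have hd := differentiable_complexSinc
  have hz := differentiable_riemannZeta₁
  have hG := (hasTwoJetAt_Gamma_one.comp_const_add 1).analyticAt.continuousAt
  have hE := (hasTwoJetAt_cpow_neg (b := 2 * Real.pi) (by simp [hpi])).analyticAt.continuousAt
  have hS : ContinuousAt (fun u : ℂ ↦ complexSinc (Real.pi / 2 * u)) 0 := by
    have : Differentiable ℂ (fun u : ℂ ↦ complexSinc (Real.pi / 2 * u)) := by fun_prop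
    exact this.continuous.continuousAt
  have hZ : ContinuousAt (fun u : ℂ ↦ riemannZeta₁ (1 + u)) 0 := by
    have : Differentiable ℂ (fun u : ℂ ↦ riemannZeta₁ (1 + u)) := by fun_prop
    exact this.continuous.continuousAt
  have hZ' : ContinuousAt (fun u : ℂ ↦ riemannZeta₁ (-u)) 0 := by
    have : Differentiable ℂ (fun u : ℂ ↦ riemannZeta₁ (-u)) := by fun_prop
    exact this.continuous.continuousAt
  refine (ContinuousAt.eventuallyEq_nhds_iff_eventuallyEq_nhdsNE ?_ hZ').1 key
  exact ContinuousAt.mul (by fun_prop) (((hE.mul hG).mul hS).mul hZ)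

lemma iteratedDeriv_two_riemannZeta₁_zero :
    iteratedDeriv 2 riemannZeta₁ 0 = deriv riemannZeta₀ 1 - Real.log (2 * Real.pi)
      - Real.eulerMascheroniConstant ^ 2 / 2 + Real.pi ^ 2 / 24
      + Real.log (2 * Real.pi) ^ 2 / 2 := by
  have hpi : (Real.pi : ℂ) ≠ 0 := by exact_mod_cast Real.pi_ne_zero
  have hlin : HasTwoJetAt (fun u : ℂ ↦ 1 / 2 * (1 + u)) 0 (1 / 2) (1 / 2) 0 := by
    have h : deriv (fun u : ℂ ↦ 1 / 2 * (1 + u)) = fun _ ↦ 1 / 2 := by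
      ext u
      simp
    refine ⟨by fun_prop, by simp, by rw [h], ?_⟩
    rw [iteratedDeriv_succ, iteratedDeriv_one, h, deriv_const]
  have h1 := hlin.mul ((((hasTwoJetAt_cpow_neg (b := 2 * Real.pi) (by simp [hpi])).mul
    (hasTwoJetAt_Gamma_one.comp_const_add 1)).mul
    (hasTwoJetAt_complexSinc.comp_const_mul differentiable_complexSinc (Real.pi / 2))).mul
    (hasTwoJetAt_riemannZeta₁_one.comp_const_add 1))
  have h2 := (h1.congr riemannZeta₁_neg_eventuallyEq).comp_neg.iteratedDeriv_eq
  simp only [neg_neg] at h2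
  have hlog : Complex.log (2 * Real.pi) = Real.log (2 * Real.pi) := by
    rw [Complex.ofReal_log (by positivity)]; push_cast; rfl
  rw [hlog] at h2
  rw [h2]
  ring

/-! ### The first Stieltjes constant. -/

lemma tendsto_stieltjesFun_one :
    Tendsto (stieltjesFun 1) (𝓝[≠] (1 : ℂ)) (𝓝 (-deriv riemannZeta₀ 1)) := by
  have h : Tendsto (fun s ↦ -deriv riemannZeta₀ s) (𝓝[≠] (1 : ℂ)) (𝓝 (-deriv riemannZeta₀ 1)) :=
    (differentiable_riemannZeta₀.deriv.continuous.neg.tendsto 1).mono_left nhdsWithin_le_nhds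
  refine h.congr' ?_
  filter_upwards [self_mem_nhdsWithin] with s hs
  rw [stieltjesFun, iteratedDeriv_one, deriv_riemannZeta_eq_neg_inv_sub_sq_add hs]
  simp
  ring

lemma stieltjesConstant_one : stieltjesConstant 1 = -deriv riemannZeta₀ 1 :=
  tendsto_stieltjesFun_one.limUnder_eq

/-! ### Hasse's series via Mellin transforms. -/

open MeasureTheory Set in
lemma integrable_and_summable_integral_of_sum_le {α : Type*} [MeasurableSpace α] {μ : Measure α}
    {f : ℕ → α → ℝ} {g : α → ℝ} (hf : ∀ n, AEStronglyMeasurable (f n) μ)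
    (h0 : ∀ᵐ t ∂μ, ∀ n, 0 ≤ f n t) (hg : Integrable g μ)
    (hle : ∀ᵐ t ∂μ, ∀ N, ∑ n ∈ Finset.range N, f n t ≤ g t) :
    (∀ n, Integrable (f n) μ) ∧ Summable fun n ↦ ∫ t, f n t ∂μ := by
  have hint : ∀ n, Integrable (f n) μ := fun n ↦ by
    refine hg.mono' (hf n) ?_
    filter_upwards [h0, hle] with t h0 hle
    rw [Real.norm_of_nonneg (h0 n)]
    exact (Finset.single_le_sum (fun i _ ↦ h0 i) (Finset.self_mem_range_succ n)).trans (hle (n + 1))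
  refine ⟨hint, summable_of_sum_range_le (c := ∫ t, g t ∂μ) (fun n ↦ ?_) fun N ↦ ?_⟩
  · exact integral_nonneg_of_ae (h0.mono fun t h ↦ h n)
  · rw [← integral_finsetSum _ fun i _ ↦ hint i]
    exact integral_mono_ae (integrable_finsetSum _ fun i _ ↦ hint i) hg (hle.mono fun t h ↦ h N)

open MeasureTheory Set in
/-- The Mellin transform of a finite combination of the exponentials `exp (-(k + 1) t)`. -/
lemma integral_cpow_mul_sum_exp {a : ℂ} (ha : 0 < a.re) (c : ℕ → ℂ) (N : ℕ) :
    ∫ t in Ioi (0 : ℝ), (t : ℂ) ^ (a - 1) * ∑ k ∈ Finset.range N, c k * Complex.exp (-((k + 1) * t))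
      = Complex.Gamma a * ∑ k ∈ Finset.range N, c k * ((k : ℂ) + 1) ^ (-a) := by
  have h (k : ℕ) : ∫ t in Ioi (0 : ℝ), (t : ℂ) ^ (a - 1) * Complex.exp (-((k + 1) * t)) =
      ((k : ℂ) + 1) ^ (-a) * Complex.Gamma a := by
    have := Complex.integral_cpow_mul_exp_neg_mul_Ioi (r := k + 1) ha (by positivity)
    push_cast at this
    rw [this, one_div, Complex.inv_cpow, Complex.cpow_neg]
    rw [← Nat.cast_add_one, Complex.natCast_arg]
    exact Real.pi_ne_zero.symm
  -- A non-integrable function has integral 0 by convention, while `h` gives a nonzero value.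
  have hint (k : ℕ) : IntegrableOn (fun t : ℝ ↦ (t : ℂ) ^ (a - 1) * Complex.exp (-((k + 1) * t)))
      (Ioi 0) := by
    by_contra hcon
    have h1 := h k
    rw [integral_undef hcon] at h1
    have h2 : ((k : ℂ) + 1) ^ (-a) ≠ 0 := by
      rw [Ne, Complex.cpow_eq_zero_iff]
      exact fun h ↦ Nat.cast_add_one_ne_zero k h.1
    exact mul_ne_zero h2 (Complex.Gamma_ne_zero_of_re_pos ha) h1.symm
  simp_rw [Finset.mul_sum, mul_left_comm _ (c _)]
  rw [integral_finsetSum _ fun k _ ↦ (hint k).const_mul _]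
  refine Finset.sum_congr rfl fun k _ ↦ ?_
  rw [integral_const_mul, h]
  ring

/-- The series of -log(1-y)/y at y = 1 - e^(-t), where -log(1-y) = t; this is the source of the
weights 1/(n+1) in Hasse's series. -/
lemma hasSum_one_sub_exp_neg_pow_div {t : ℝ} (ht : 0 < t) :
    HasSum (fun n : ℕ ↦ (1 - Real.exp (-t)) ^ n / (n + 1)) (t / (1 - Real.exp (-t))) := by
  have h1 : Real.exp (-t) < 1 := by simpa using ht
  have hy : 0 < 1 - Real.exp (-t) := by linarith
  have h := Real.hasSum_pow_div_log_of_abs_lt_one (x := 1 - Real.exp (-t))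
    (by rw [abs_of_pos hy]; linarith [Real.exp_pos (-t)])
  rw [sub_sub_cancel, Real.log_exp, neg_neg] at h
  refine (h.div_const (1 - Real.exp (-t))).congr_fun fun n ↦ ?_
  rw [pow_succ]
  field_simp

lemma div_one_sub_exp_neg_le {t : ℝ} (ht : 0 < t) : t / (1 - Real.exp (-t)) ≤ 1 + t := by
  have h1 : Real.exp (-t) < 1 := by simpa using ht
  rw [div_le_iff₀ (by linarith)]
  have h2 : Real.exp (-t) * (1 + t) ≤ 1 := by
    have := Real.add_one_le_exp t
    calc Real.exp (-t) * (1 + t) ≤ Real.exp (-t) * Real.exp t := by gcongr; linarith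
      _ = 1 := by rw [← Real.exp_add]; simp
  linarith

lemma mellin_exp_neg_div_one_sub_exp_neg {s : ℂ} (hs : 1 < s.re) :
    mellin (fun t ↦ ((Real.exp (-t) / (1 - Real.exp (-t)) : ℝ) : ℂ)) s =
      Complex.Gamma s * riemannZeta s := by
  have h := hasSum_mellin (a := fun _ : ℕ ↦ (1 : ℂ)) (p := fun n ↦ (n : ℝ) + 1)
    (F := fun t ↦ ((Real.exp (-t) / (1 - Real.exp (-t)) : ℝ) : ℂ)) (s := s)
    (fun i ↦ Or.inr (by positivity)) (by linarith) ?_ ?_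
  · rw [← h.tsum_eq, zeta_eq_tsum_one_div_nat_add_one_cpow hs, ← tsum_mul_left]
    refine tsum_congr fun n ↦ ?_
    push_cast
    ring
  · intro t ht
    have h1 : Real.exp (-t) < 1 := by simpa using ht
    have := (hasSum_geometric_of_lt_one (Real.exp_pos (-t)).le h1).mul_left (Real.exp (-t))
    rw [← div_eq_mul_inv] at this
    refine ((Complex.hasSum_ofReal.2 this)).congr_fun fun n ↦ ?_
    rw [one_mul, ← Real.exp_nat_mul, ← Real.exp_add]
    congr 2
    ring
  · have := (summable_nat_add_iff 1).2 (Real.summable_one_div_nat_rpow.2 hs)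
    simpa using this

open MeasureTheory Set in
/-- Hasse's series for `(s - 1) ζ(s)` in the half plane `2 < re s`. -/
lemma hasSum_hasse {s : ℂ} (hs : 2 < s.re) :
    HasSum (fun n : ℕ ↦ 1 / ((n : ℂ) + 1) * ∑ k ∈ Finset.range (n + 1),
      (n.choose k : ℂ) * (-1) ^ k * ((k : ℂ) + 1) ^ (1 - s)) (riemannZeta₁ s) := by
  let f : ℕ → ℝ → ℝ := fun n t ↦ t ^ (s.re - 2) * Real.exp (-t) *
    ((1 - Real.exp (-t)) ^ n / (n + 1))
  let F : ℕ → ℝ → ℂ := fun n t ↦ (t : ℂ) ^ (s - 1 - 1) * ((Real.exp (-t) *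
    ((1 - Real.exp (-t)) ^ n / (n + 1)) : ℝ) : ℂ)
  have hyp {t : ℝ} (ht : t ∈ Ioi (0 : ℝ)) : 0 < 1 - Real.exp (-t) := by
    have : Real.exp (-t) < 1 := by simpa using ht
    linarith
  have hf0 {t : ℝ} (ht : t ∈ Ioi (0 : ℝ)) (n : ℕ) : 0 ≤ f n t := by
    have := hyp ht
    have : 0 < t := ht
    positivity
  have hg : IntegrableOn (fun t : ℝ ↦ t ^ (s.re - 2) * Real.exp (-t) * (1 + t)) (Ioi 0) := by
    have h1 := Real.GammaIntegral_convergent (s := s.re - 1) (by linarith)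
    have h2 := Real.GammaIntegral_convergent (s := s.re) (by linarith)
    refine (h1.add h2).congr_fun (fun t ht ↦ ?_) measurableSet_Ioi
    have : t ^ (s.re - 1) = t ^ (s.re - 2) * t := by
      rw [← Real.rpow_add_one (ne_of_gt ht)]; congr 1; ring
    simp only [Pi.add_apply, this, show s.re - 1 - 1 = s.re - 2 by ring]
    ring
  have hcontF (n : ℕ) : ContinuousOn (F n) (Ioi 0) := by
    refine ContinuousOn.mul (fun t ht ↦ ?_) (by fun_prop)
    exact (Complex.continuousAt_ofReal_cpow_const _ _ (Or.inr (ne_of_gt ht))).continuousWithinAt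
  have hnorm {t : ℝ} (ht : t ∈ Ioi (0 : ℝ)) (n : ℕ) : ‖F n t‖ = f n t := by
    have := hyp ht
    have ht' : 0 < t := ht
    simp only [F, f]
    rw [norm_mul, Complex.norm_cpow_eq_rpow_re_of_pos ht, Complex.norm_real,
      Real.norm_of_nonneg (by positivity)]
    simp
    ring_nf
  have hmeas (n : ℕ) : AEStronglyMeasurable (f n) (volume.restrict (Ioi 0)) :=
    ((hcontF n).norm.congr fun t ht ↦ (hnorm ht n).symm).aestronglyMeasurable measurableSet_Ioi
  have hle : ∀ t ∈ Ioi (0 : ℝ), ∀ N, ∑ n ∈ Finset.range N, f n t ≤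
      t ^ (s.re - 2) * Real.exp (-t) * (1 + t) := by
    intro t ht N
    simp only [f, ← Finset.mul_sum]
    have ht' : 0 < t := ht
    have := hyp ht
    refine mul_le_mul_of_nonneg_left ?_ (by positivity)
    exact (sum_le_hasSum _ (fun i _ ↦ by positivity)
      (hasSum_one_sub_exp_neg_pow_div ht)).trans (div_one_sub_exp_neg_le ht)
  obtain ⟨hint, hsum⟩ := integrable_and_summable_integral_of_sum_le hmeas
    (ae_restrict_of_forall_mem measurableSet_Ioi fun t ht ↦ hf0 ht) hg
    (ae_restrict_of_forall_mem measurableSet_Ioi hle)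
  have hintF (n : ℕ) : Integrable (F n) (volume.restrict (Ioi 0)) :=
    (hint n).mono' ((hcontF n).aestronglyMeasurable measurableSet_Ioi)
      (ae_restrict_of_forall_mem measurableSet_Ioi fun t ht ↦ (hnorm ht n).le)
  have hsumF := hasSum_integral_of_summable_integral_norm hintF <| by
    convert hsum using 2 with n
    exact setIntegral_congr_fun measurableSet_Ioi fun t ht ↦ hnorm ht n
  have hG : Complex.Gamma (s - 1) ≠ 0 := Complex.Gamma_ne_zero_of_re_pos (by simp; linarith)
  have hs1 : s ≠ 1 := by rintro rfl; norm_num at hs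
  -- Summing over n under the integral leaves t^(s-1) e^(-t)/(1-e^(-t)), the Mellin integrand of
  -- Γ(s)ζ(s); then Γ(s) = (s-1)Γ(s-1).
  have htot : ∫ t in Ioi (0 : ℝ), ∑' n, F n t = Complex.Gamma (s - 1) * riemannZeta₁ s := by
    have h1 : riemannZeta₁ s = (s - 1) * riemannZeta s := by
      rw [riemannZeta_eq_inv_sub_mul hs1, mul_inv_cancel_left₀ (sub_ne_zero.2 hs1)]
    have h2 := Complex.Gamma_add_one (s - 1) (sub_ne_zero.2 hs1)
    rw [sub_add_cancel] at h2
    rw [h1, ← mul_assoc, mul_comm (Complex.Gamma _), ← h2,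
      ← mellin_exp_neg_div_one_sub_exp_neg (by linarith), mellin]
    refine setIntegral_congr_fun measurableSet_Ioi fun t ht ↦ ?_
    have h3 := (Complex.hasSum_ofReal.2 ((hasSum_one_sub_exp_neg_pow_div ht).mul_left
      (Real.exp (-t)))).mul_left ((t : ℂ) ^ (s - 1 - 1))
    have ht0 : (t : ℂ) ≠ 0 := by exact_mod_cast ne_of_gt ht
    have h4 : (t : ℂ) ^ (s - 1) = (t : ℂ) ^ (s - 1 - 1) * t := by
      rw [Complex.cpow_sub (s - 1) 1 ht0, Complex.cpow_one, div_mul_cancel₀ _ ht0]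
    simp only [F]
    rw [h3.tsum_eq, smul_eq_mul, h4]
    push_cast
    ring
  rw [htot] at hsumF
  have hfin := hsumF.div_const (Complex.Gamma (s - 1))
  rw [mul_div_cancel_left₀ _ hG] at hfin
  refine hfin.congr_fun fun n ↦ ?_
  have hF : ∫ t in Ioi (0 : ℝ), F n t = ∫ t in Ioi (0 : ℝ), (t : ℂ) ^ (s - 1 - 1) *
      ∑ k ∈ Finset.range (n + 1), (1 / ((n : ℂ) + 1) * ((n.choose k : ℂ) * (-1) ^ k)) *
        Complex.exp (-((k + 1) * t)) := by
    refine setIntegral_congr_fun measurableSet_Ioi fun t _ ↦ ?_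
    simp only [F]
    push_cast
    simp_rw [mul_assoc, ← Finset.mul_sum]
    rw [sub_eq_neg_add 1, add_pow, mul_div_assoc', Finset.mul_sum, div_eq_inv_mul, one_div]
    congr 2
    refine Finset.sum_congr rfl fun k _ ↦ ?_
    rw [neg_pow, ← Complex.exp_nat_mul, show -(((k : ℂ) + 1) * t) = -t + k * -t by ring,
      Complex.exp_add]
    ring
  rw [hF, integral_cpow_mul_sum_exp (by simp; linarith), mul_div_cancel_left₀ _ hG, neg_sub]
  simp_rw [mul_assoc, ← Finset.mul_sum]

/-! ### The differenced series. -/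

/-- The entire functions `(1 / (n + 1)) ∑ k, (n choose k) (-1)^k k (k + 1)^(-s)`. -/
noncomputable def hasseDiffTerm (n : ℕ) (s : ℂ) : ℂ :=
  1 / ((n : ℂ) + 1) * ∑ k ∈ Finset.range (n + 1),
    (n.choose k : ℂ) * (-1) ^ k * k * ((k : ℂ) + 1) ^ (-s)

lemma hasTwoJetAt_natCast_add_one_cpow_neg (k : ℕ) :
    HasTwoJetAt (fun s : ℂ ↦ ((k : ℂ) + 1) ^ (-s)) 0 1 (-Complex.log (k + 1))
      (Complex.log (k + 1) ^ 2) :=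
  hasTwoJetAt_cpow_neg (Nat.cast_add_one_ne_zero k)

lemma differentiable_hasseDiffTerm (n : ℕ) : Differentiable ℂ (hasseDiffTerm n) := by
  refine Differentiable.const_mul (Differentiable.fun_sum fun k _ ↦ ?_) _
  exact Differentiable.const_mul (fun u ↦
    (differentiableAt_id.neg).const_cpow (Or.inl (Nat.cast_add_one_ne_zero k))) _

lemma iteratedDeriv_two_hasseDiffTerm_zero (n : ℕ) :
    iteratedDeriv 2 (hasseDiffTerm n) 0 =
      (((1 / ((n : ℝ) + 1)) * ∑ k ∈ Finset.range (n + 1),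
        (n.choose k : ℝ) * (-1 : ℝ) ^ k * (k : ℝ) * Real.log ((k : ℝ) + 1) ^ 2 : ℝ) : ℂ) := by
  have hj (k : ℕ) := hasTwoJetAt_natCast_add_one_cpow_neg k
  have hc (k : ℕ) : ContDiffAt ℂ 2 (fun s : ℂ ↦ (n.choose k : ℂ) * (-1) ^ k * k *
      ((k : ℂ) + 1) ^ (-s)) 0 := (analyticAt_const.mul (hj k).analyticAt).contDiffAt
  unfold hasseDiffTerm
  rw [iteratedDeriv_const_mul_field, iteratedDeriv_fun_sum fun k _ ↦ hc k]
  push_cast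
  congr 1
  refine Finset.sum_congr rfl fun k _ ↦ ?_
  rw [iteratedDeriv_const_mul_field, (hj k).iteratedDeriv_eq, Complex.ofReal_log (by positivity)]
  push_cast
  rfl

lemma hasSum_hasseDiffTerm_of_two_lt_re {s : ℂ} (hs : 2 < s.re) :
    HasSum (fun n ↦ hasseDiffTerm n s) (riemannZeta₁ s - riemannZeta₁ (1 + s)) := by
  have h1 := hasSum_hasse hs
  have h2 := hasSum_hasse (s := 1 + s) (by simp; linarith)
  refine (h1.sub h2).congr_fun fun n ↦ ?_
  rw [hasseDiffTerm, ← mul_sub, ← Finset.sum_sub_distrib]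
  congr 1
  refine Finset.sum_congr rfl fun k _ ↦ ?_
  rw [sub_eq_add_neg 1 s, Complex.cpow_add _ _ (Nat.cast_add_one_ne_zero k), Complex.cpow_one,
    show 1 - (1 + s) = -s by ring]
  ring

/-! ### Summable bounds for the differenced terms. -/

/-- `(1 / (n + 1)) ∑ k, (n choose k) (-1)^k k (k + 1) x^k` in closed form. -/
noncomputable def hasseKernel (n : ℕ) (x : ℝ) : ℝ :=
  1 / ((n : ℝ) + 1) * -(n * (2 * x * (1 - x) ^ (n - 1) - ((n - 1 : ℕ) : ℝ) * x ^ 2 *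
    (1 - x) ^ (n - 1 - 1)))

/-- The operator p ↦ (X² p')' multiplies X^k by k(k+1); apply it to (1-X)^n. Truncated exponents are
harmless, as the coefficients n and n - 1 vanish there. -/
lemma sum_choose_mul_eq_hasseKernel (n : ℕ) (x : ℝ) :
    1 / ((n : ℝ) + 1) * ∑ k ∈ Finset.range (n + 1),
      (n.choose k : ℝ) * (-1) ^ k * k * (k + 1) * x ^ k = hasseKernel n x := by
  open Polynomial in
  have h : (1 - X : ℝ[X]) ^ n = ∑ k ∈ Finset.range (n + 1), C ((n.choose k : ℝ) * (-1) ^ k) *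
      X ^ k := by
    rw [sub_eq_neg_add, add_pow]
    refine Finset.sum_congr rfl fun k _ ↦ ?_
    rw [neg_pow]
    simp
    ring
  have h2 := congrArg (fun p : Polynomial ℝ ↦ (Polynomial.derivative (Polynomial.X ^ 2 *
    Polynomial.derivative p)).eval x) h
  simp only [Polynomial.derivative_sum, Finset.mul_sum, Polynomial.eval_finsetSum] at h2
  rw [hasseKernel]
  congr 1
  calc _ = _ := Finset.sum_congr rfl fun k _ ↦ ?_
    _ = _ := h2.symm
    _ = _ := ?_
  · cases k with
    | zero => simp
    | succ k =>
      simp [Polynomial.derivative_pow]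
      cases k with
      | zero => simp; ring
      | succ k => simp; ring
  · simp [Polynomial.derivative_pow]
    ring

/-- A nonnegative majorant of `hasseKernel n` on `[0, 1]`. -/
noncomputable def hasseMajorant (n : ℕ) (x : ℝ) : ℝ :=
  2 * x * (1 - x) ^ n + n * x ^ 2 * (1 - x) ^ (n - 1)

lemma hasseMajorant_nonneg (n : ℕ) {x : ℝ} (h0 : 0 ≤ x) (h1 : x ≤ 1) : 0 ≤ hasseMajorant n x := by
  have : 0 ≤ 1 - x := by linarith
  unfold hasseMajorant
  positivity

lemma sum_hasseMajorant_le (N : ℕ) {x : ℝ} (h0 : 0 ≤ x) (h1 : x ≤ 1) :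
    ∑ n ∈ Finset.range N, hasseMajorant n x ≤ 3 := by
  have hy : 0 ≤ 1 - x := by linarith
  -- For 0 < x ≤ 1 the two full series sum to 2 and 1, hence the 3.
  have h : ∑ n ∈ Finset.range N, hasseMajorant n x =
      3 - 3 * (1 - x) ^ N - N * x * (1 - x) ^ (N - 1) := by
    induction N with
    | zero => simp
    | succ N ih =>
      rw [Finset.sum_range_succ, ih, hasseMajorant]
      cases N with
      | zero => simp; ring
      | succ N => simp; ring
  rw [h]
  have : 0 ≤ 3 * (1 - x) ^ N + N * x * (1 - x) ^ (N - 1) := by positivity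
  linarith

lemma abs_hasseKernel_succ_le (n : ℕ) {x : ℝ} (h0 : 0 ≤ x) (h1 : x ≤ 1) :
    |hasseKernel (n + 1) x| ≤ hasseMajorant n x := by
  have hy : 0 ≤ 1 - x := by linarith
  rw [hasseKernel, mul_neg, abs_neg, ← mul_assoc, abs_mul, abs_of_nonneg (by positivity)]
  simp only [Nat.add_sub_cancel]
  have h2 : |2 * x * (1 - x) ^ n - n * x ^ 2 * (1 - x) ^ (n - 1)| ≤ hasseMajorant n x := by
    refine (abs_sub _ _).trans ?_
    rw [abs_of_nonneg (by positivity), abs_of_nonneg (by positivity), hasseMajorant]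
  have h3 : 1 / (((n + 1 : ℕ) : ℝ) + 1) * ((n + 1 : ℕ) : ℝ) ≤ 1 := by
    rw [one_div, inv_mul_le_iff₀ (by positivity)]
    linarith
  calc _ ≤ 1 * hasseMajorant n x := by gcongr
    _ = _ := one_mul _

section

open MeasureTheory Set

/-- Taking the Mellin exponent s + 1, with a compensating factor k + 1 in the kernel, reaches re s >
-1 and so includes s = 0. -/
lemma Gamma_mul_hasseDiffTerm (n : ℕ) {s : ℂ} (hs : -1 < s.re) :
    Complex.Gamma (s + 1) * hasseDiffTerm n s =
      ∫ t in Ioi (0 : ℝ), (t : ℂ) ^ s * ((Real.exp (-t) * hasseKernel n (Real.exp (-t)) : ℝ) : ℂ) := by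
  have h := integral_cpow_mul_sum_exp (a := s + 1) (by simp; linarith)
    (fun k ↦ 1 / ((n : ℂ) + 1) * ((n.choose k : ℂ) * (-1) ^ k * k * (k + 1))) (n + 1)
  rw [add_sub_cancel_right] at h
  have h2 : hasseDiffTerm n s = ∑ k ∈ Finset.range (n + 1), (1 / ((n : ℂ) + 1) *
      ((n.choose k : ℂ) * (-1) ^ k * k * (k + 1))) * ((k : ℂ) + 1) ^ (-(s + 1)) := by
    rw [hasseDiffTerm, Finset.mul_sum]
    refine Finset.sum_congr rfl fun k _ ↦ ?_
    have hk : (k : ℂ) + 1 ≠ 0 := Nat.cast_add_one_ne_zero k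
    rw [neg_add, Complex.cpow_add _ _ hk, Complex.cpow_neg_one]
    field_simp
  rw [h2, ← h]
  refine setIntegral_congr_fun measurableSet_Ioi fun t _ ↦ ?_
  rw [← sum_choose_mul_eq_hasseKernel]
  push_cast
  simp_rw [Finset.mul_sum]
  refine Finset.sum_congr rfl fun k _ ↦ ?_
  rw [← Complex.exp_nat_mul, show -(((k : ℂ) + 1) * t) = -t + k * -t by ring, Complex.exp_add]
  ring

lemma exists_summable_bound_hasseDiffTerm : ∃ u : ℕ → ℝ, Summable u ∧
    ∀ n, ∀ s ∈ Metric.ball (1 : ℂ) (3 / 2), ‖hasseDiffTerm n s‖ ≤ u n := by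
  obtain ⟨M, hM⟩ := (isCompact_closedBall (1 : ℂ) (3 / 2)).exists_bound_of_continuousOn
    (f := fun s ↦ (Complex.Gamma (s + 1))⁻¹)
    (Complex.differentiable_one_div_Gamma.continuous.comp (continuous_add_const 1)).continuousOn
  -- The disc gives -1/2 < re s < 5/2, so t^(re s) is at most the sum of the two extreme powers.
  let g : ℝ → ℝ := fun t ↦ (t ^ (-1 / 2 : ℝ) + t ^ (5 / 2 : ℝ)) * Real.exp (-t)
  have hx {t : ℝ} (ht : t ∈ Ioi (0 : ℝ)) : Real.exp (-t) ≤ 1 := by simpa using le_of_lt ht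
  have hg0 {t : ℝ} (ht : t ∈ Ioi (0 : ℝ)) : 0 ≤ g t := by
    have : 0 < t := ht
    positivity
  have hg : IntegrableOn (fun t ↦ g t * 3) (Ioi 0) := by
    have h1 := Real.GammaIntegral_convergent (s := 1 / 2) (by norm_num)
    have h2 := Real.GammaIntegral_convergent (s := 7 / 2) (by norm_num)
    have h3 : IntegrableOn (fun t ↦ (Real.exp (-t) * t ^ (1 / 2 - 1 : ℝ) +
        Real.exp (-t) * t ^ (7 / 2 - 1 : ℝ)) * 3) (Ioi 0) := (h1.add h2).mul_const 3
    refine h3.congr_fun (fun t ht ↦ ?_) measurableSet_Ioi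
    simp only [g]
    norm_num
    ring
  have hcont (n : ℕ) : ContinuousOn (fun t ↦ g t * hasseMajorant n (Real.exp (-t))) (Ioi 0) := by
    refine ContinuousOn.mul (ContinuousOn.mul (fun t ht ↦ ContinuousAt.continuousWithinAt ?_)
      (by fun_prop)) (by unfold hasseMajorant; fun_prop)
    exact (Real.continuousAt_rpow_const _ _ (Or.inl (ne_of_gt ht))).add
      (Real.continuousAt_rpow_const _ _ (Or.inl (ne_of_gt ht)))
  obtain ⟨hint, hsum⟩ := integrable_and_summable_integral_of_sum_le
    (fun n ↦ (hcont n).aestronglyMeasurable measurableSet_Ioi)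
    (ae_restrict_of_forall_mem measurableSet_Ioi fun t ht n ↦
      mul_nonneg (hg0 ht) (hasseMajorant_nonneg n (Real.exp_pos _).le (hx ht))) hg
    (ae_restrict_of_forall_mem measurableSet_Ioi fun t ht N ↦ by
      rw [← Finset.mul_sum]
      exact mul_le_mul_of_nonneg_left (sum_hasseMajorant_le N (Real.exp_pos _).le (hx ht)) (hg0 ht))
  let v : ℕ → ℝ := fun n ↦ M * ∫ t in Ioi (0 : ℝ), g t * hasseMajorant n (Real.exp (-t))
  -- The term n = 0 vanishes; the majorant of index n bounds the term n + 1.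
  refine ⟨fun n ↦ n.casesOn 0 v, (summable_nat_add_iff 1).1 (hsum.mul_left M), fun n s hs ↦ ?_⟩
  cases n with
  | zero => simp [hasseDiffTerm]
  | succ n =>
    have hre : |s.re - 1| < 3 / 2 := by
      have h1 : ‖s - 1‖ < 3 / 2 := by simpa [dist_eq_norm] using hs
      have h2 := Complex.abs_re_le_norm (s - 1)
      simp only [Complex.sub_re, Complex.one_re] at h2
      linarith
    rw [abs_lt] at hre
    have hG : Complex.Gamma (s + 1) ≠ 0 := Complex.Gamma_ne_zero_of_re_pos (by simp; linarith)
    have h1 := Gamma_mul_hasseDiffTerm (n + 1) (s := s) (by linarith)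
    rw [← eq_inv_mul_iff_mul_eq₀ hG] at h1
    rw [h1, norm_mul]
    refine mul_le_mul (hM s (Metric.ball_subset_closedBall hs)) ?_ (norm_nonneg _)
      ((norm_nonneg _).trans (hM s (Metric.ball_subset_closedBall hs)))
    refine norm_integral_le_of_norm_le (hint n)
      (ae_restrict_of_forall_mem measurableSet_Ioi fun t ht ↦ ?_)
    have ht' : 0 < t := ht
    rw [norm_mul, Complex.norm_cpow_eq_rpow_re_of_pos ht, Complex.norm_real, norm_mul,
      Real.norm_of_nonneg (Real.exp_pos _).le, ← mul_assoc]
    refine mul_le_mul (mul_le_mul_of_nonneg_right ?_ (Real.exp_pos _).le)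
      (abs_hasseKernel_succ_le n (Real.exp_pos _).le (hx ht)) (norm_nonneg _) (hg0 ht)
    rcases le_total t 1 with h | h
    · have := Real.rpow_le_rpow_of_exponent_ge ht' h (show (-1 / 2 : ℝ) ≤ s.re by linarith)
      have : 0 ≤ t ^ (5 / 2 : ℝ) := by positivity
      linarith
    · have := Real.rpow_le_rpow_of_exponent_le h (show s.re ≤ (5 / 2 : ℝ) by linarith)
      have : 0 ≤ t ^ (-1 / 2 : ℝ) := by positivity
      linarith

/-! ### Continuation to 0 and termwise differentiation. -/

lemma hasSum_iteratedDeriv_two_hasseDiffTerm :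
    HasSum (fun n ↦ iteratedDeriv 2 (hasseDiffTerm n) 0)
      (iteratedDeriv 2 riemannZeta₁ 0 - iteratedDeriv 2 riemannZeta₁ 1) := by
  obtain ⟨u, hu, hle⟩ := exists_summable_bound_hasseDiffTerm
  set U := Metric.ball (1 : ℂ) (3 / 2) with hU
  have hUo : IsOpen U := Metric.isOpen_ball
  have hF (n : ℕ) : DifferentiableOn ℂ (hasseDiffTerm n) U :=
    (differentiable_hasseDiffTerm n).differentiableOn
  have h0U : (0 : ℂ) ∈ U := by simp [hU]; norm_num
  have hz := differentiable_riemannZeta₁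
  have hz' : Differentiable ℂ (fun s ↦ riemannZeta₁ (1 + s)) := by fun_prop
  set G : ℂ → ℂ := fun s ↦ ∑' n, hasseDiffTerm n s
  have hG : EqOn G (fun s ↦ riemannZeta₁ s - riemannZeta₁ (1 + s)) U := by
    have hGd : DifferentiableOn ℂ G U :=
      Complex.differentiableOn_tsum_of_summable_norm hu hF hUo hle
    -- The point 9/4 lies in the disc and in re s > 2, where the identity is known.
    refine (hGd.analyticOnNhd hUo).eqOn_of_preconnected_of_eventuallyEq
      ((hz.sub hz').differentiableOn.analyticOnNhd hUo)
      (convex_ball _ _).isPreconnected (z₀ := 9 / 4) ?_ ?_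
    · rw [hU, Metric.mem_ball, dist_eq_norm]; norm_num
    · have : {s : ℂ | 2 < s.re} ∈ 𝓝 (9 / 4 : ℂ) :=
        (isOpen_lt continuous_const Complex.continuous_re).mem_nhds (by norm_num)
      filter_upwards [this] with s hs using (hasSum_hasseDiffTerm_of_two_lt_re hs).tsum_eq
  -- Convergence is along finite subsets of ℕ, so the differentiated series is summed
  -- unconditionally, hence absolutely.
  have hloc := (tendstoUniformlyOn_tsum hu hle).tendstoLocallyUniformlyOn
  have hd (T : Finset ℕ) : Differentiable ℂ (fun s ↦ ∑ n ∈ T, hasseDiffTerm n s) :=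
    Differentiable.fun_sum fun n _ ↦ differentiable_hasseDiffTerm n
  have hloc2 := (hloc.deriv (Eventually.of_forall fun T ↦ (hd T).differentiableOn) hUo).deriv
    (Eventually.of_forall fun T ↦ (hd T).deriv.differentiableOn) hUo
  have hlim := hloc2.tendsto_at h0U
  have hval : deriv (deriv G) 0 = iteratedDeriv 2 riemannZeta₁ 0 - iteratedDeriv 2 riemannZeta₁ 1 := by
    have h1 := (hG.eventuallyEq_of_mem (hUo.mem_nhds h0U)).iteratedDeriv_eq 2
    rw [iteratedDeriv_succ, iteratedDeriv_one, iteratedDeriv_fun_sub hz.contDiff.contDiffAt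
      hz'.contDiff.contDiffAt, iteratedDeriv_comp_const_add] at h1
    simpa using h1
  rw [← hval]
  refine hlim.congr fun T ↦ ?_
  rw [← iteratedDeriv_fun_sum fun n _ ↦ (differentiable_hasseDiffTerm n).contDiff.contDiffAt,
    iteratedDeriv_succ, iteratedDeriv_one]
  rfl

end

theorem mainTheorem6 :
    Tendsto (stieltjesFun 1) (𝓝[≠] (1 : ℂ)) (𝓝 (stieltjesConstant 1)) ∧
    HasSum
      (fun n : ℕ =>
        (((1 / ((n : ℝ) + 1)) *
          ∑ k ∈ Finset.range (n + 1),
            (n.choose k : ℝ) * (-1 : ℝ) ^ k * (k : ℝ) * Real.log ((k : ℝ) + 1) ^ 2 : ℝ) : ℂ))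
      (stieltjesConstant 1 +
        ((-Real.log (2 * Real.pi)
          - (1 / 2) * Real.eulerMascheroniConstant ^ 2
          + (1 / 24) * Real.pi ^ 2
          + (1 / 2) * Real.log (2 * Real.pi) ^ 2 : ℝ) : ℂ)) := by
  refine ⟨stieltjesConstant_one ▸ tendsto_stieltjesFun_one, ?_⟩
  have h := hasSum_iteratedDeriv_two_hasseDiffTerm
  simp_rw [iteratedDeriv_two_hasseDiffTerm_zero] at h
  rw [iteratedDeriv_two_riemannZeta₁_zero, hasTwoJetAt_riemannZeta₁_one.iteratedDeriv_eq] at h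
  rw [stieltjesConstant_one]
  convert h using 1
  push_cast
  ring
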